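/- Let $h\ge 0$, $\mu>0$ and $0\le\theta<\pi/2$. Consider a horizontally infinite, two-sided, non-Beerian (i.e. without absorption along the path) porous bed of height $h$ with opaque particles, whose beam lengths are exponentially distributed with rate $\mu$ (density $\mu e^{-\mu y}$, $y\ge 0$). A ray incident at angle $\theta$ is first scattered at depth $\tilde x=x\cos\theta$, where $x\sim\mathrm{Exp}(\mu)$. Its depths at the successive scattering events are modeled by the two-sided $(\tilde x,h,\tfrac12,\mathrm{Exp}(\mu))$-renewal process $X_n=\tilde x+\sum_{i=1}^n s_iY_i$, where $x$, the sides $s_i$ ($\pm1$ with probability $\tfrac12$ each) and the step sizes $Y_i\sim\mathrm{Exp}(\mu)$ are mutually independent. The process terminates at $T=\min\{n\ge 0: X_n<0\text{ or }X_n>h\}$, and the reflection fraction is $\rho_\theta=\mathbb{E}_x\,\rho_{x\cos\theta}$, where $\rho_{\tilde x}=\mathbb{P}(X_T<0)$ for the process started at $\tilde x$. (In particular, a ray with $x\cos\theta>h$ is transmitted.) Then $$\rho_\theta=\frac{(1-\cos\theta)\left(1-e^{-h\mu/\cos\theta}\right)+h\mu}{h\mu+2}.$$ -/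

import Mathlib

open MeasureTheory ProbabilityTheory Set

noncomputable section

namespace PorousBed

/-- The law of the side of a step: `+1` (increasing depth) with probability `p` and `-1`
(decreasing depth) with probability `q = 1 - p`. -/
def sideLaw (p : unitInterval) : Measure ℝ :=
  ENNReal.ofReal (p : ℝ) • Measure.dirac 1 + ENNReal.ofReal (1 - (p : ℝ)) • Measure.dirac (-1)

instance (p : unitInterval) : IsProbabilityMeasure (sideLaw p) := by
  constructor
  simp only [sideLaw, Measure.add_apply, Measure.smul_apply, measure_univ, smul_eq_mul, mul_one]
  rw [← ENNReal.ofReal_add p.2.1 (sub_nonneg.2 p.2.2)]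
  simp

/-- The joint law of the independent steps `i ↦ (s i, Y i)` of a walk, where the sides `s i` have
law `sideLaw p` and the step sizes `Y i` have law `F`, all of them mutually independent. -/
def stepsLaw (p : unitInterval) (F : Measure ℝ) [IsProbabilityMeasure F] :
    Measure (ℕ → ℝ × ℝ) :=
  Measure.infinitePi fun _ => (sideLaw p).prod F

/-- The position `x + ∑ i < n, s i * Y i` after `n` steps of the walk started at `x`, where
`ω i = (s i, Y i)`. -/
def position (x : ℝ) (ω : ℕ → ℝ × ℝ) (n : ℕ) : ℝ :=
  x + ∑ i ∈ Finset.range n, (ω i).1 * (ω i).2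

/-- `n` is the stopping time of the walk started at `x`: the first time (time `0` included) at which
the position is less than `0` or larger than `h`. -/
def IsExitTime (x h : ℝ) (ω : ℕ → ℝ × ℝ) (n : ℕ) : Prop :=
  IsLeast {k : ℕ | position x ω k < 0 ∨ h < position x ω k} n

/-- The probability that the two-sided `(x, h, p, F)`-renewal process terminates below `0`. -/
def exitBelowProb (x h : ℝ) (p : unitInterval) (F : Measure ℝ) [IsProbabilityMeasure F] : ℝ :=
  (stepsLaw p F).real {ω | ∃ n, IsExitTime x h ω n ∧ position x ω n < 0}

/-- The probability `1 / 2` of either side under isotropic scattering. -/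
def isotropic : unitInterval := ⟨1 / 2, by norm_num, by norm_num⟩

/-- The reflection fraction, at incidence angle `θ`, of a non-absorbing (non-Beerian, opaque
particles) two-sided bed of height `h` with beam length law `F`: the ray travels a length `l` with
law `F` in the incident direction, so it is first scattered at depth `l * cos θ` (it is transmitted
without scattering if that exceeds `h`); from there on its depths at the scattering events are an
isotropic two-sided renewal process with step law `F`, and, as no power is absorbed, the reflected
fraction of its power is the probability that it leaves through the irradiated face. -/
def reflectionFraction (h θ : ℝ) (F : Measure ℝ) [IsProbabilityMeasure F] : ℝ :=
  ∫ l, exitBelowProb (l * Real.cos θ) h isotropic F ∂F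

end PorousBed

end

open scoped Topology

namespace PorousBed

/-! ### Integrals of truncated affine functions against the exponential law. -/

section ExponentialLaw

/-! Conditioning on the first step shows that, on `[0, h]`, the probability of leaving below `0` is
the mean of its own averages over one step up and one step down, with values `1` below `0` and `0`
above `h` (`exitBelowProb_eq_integral`). By memorylessness the overshoot at either end is again
exponential, with mean `1 / μ`, so the driftless walk behaves as if absorbed at `-1 / μ` and `h + 1
/ μ`. This suggests the affine solution `(h * μ + 1 - μ * x) / (h * μ + 2)`, which is checked
directly in `affineExitProb_eq_average`. Uniqueness among bounded solutions is a contraction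
argument (`eq_zero_of_eq_average`), so almost sure termination is never needed. Averaging the affine
formula over the first flight gives the result. -/

lemma ae_nonneg_expMeasure {μ : ℝ} : ∀ᵐ y ∂(expMeasure μ), 0 ≤ y := by
  rw [ae_iff]
  have hset : {y : ℝ | ¬ 0 ≤ y} = Iio 0 := by ext; simp
  rw [hset, expMeasure, gammaMeasure, withDensity_apply _ measurableSet_Iio]
  exact lintegral_gammaPDF_of_nonpos le_rfl

lemma setIntegral_affine_expMeasure {μ L : ℝ} (hμ : 0 < μ) (hL : 0 ≤ L) (α β : ℝ) :
    ∫ y in Icc 0 L, (α + β * y) ∂(expMeasure μ) =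
      α * (1 - Real.exp (-(μ * L))) +
        β * ((1 - Real.exp (-(μ * L))) / μ - L * Real.exp (-(μ * L))) := by
  have hmeas : Measurable (exponentialPDF μ) :=
    (measurable_exponentialPDFReal μ).ennreal_ofReal
  have h₁ : ∫ y in Icc 0 L, (α + β * y) ∂(expMeasure μ) =
      ∫ y in Icc 0 L, μ * Real.exp (-(μ * y)) * (α + β * y) := by
    change ∫ y in Icc 0 L, (α + β * y) ∂(volume.withDensity (exponentialPDF μ)) = _
    rw [restrict_withDensity measurableSet_Icc,
      integral_withDensity_eq_integral_toReal_smul hmeas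
        (Filter.Eventually.of_forall fun y => ENNReal.ofReal_lt_top)]
    refine setIntegral_congr_fun measurableSet_Icc fun y hy => ?_
    have hnn : 0 ≤ μ * Real.exp (-(μ * y)) := by positivity
    simp only [exponentialPDF_of_nonneg hy.1, ENNReal.toReal_ofReal hnn, smul_eq_mul]
  rw [h₁, integral_Icc_eq_integral_Ioc, ← intervalIntegral.integral_of_le hL]
  have hderiv : ∀ y ∈ uIcc 0 L, HasDerivAt
      (fun y => -((α + β * y + β / μ) * Real.exp (-(μ * y))))
      (μ * Real.exp (-(μ * y)) * (α + β * y)) y := by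
    intro y _
    have he : HasDerivAt (fun y : ℝ => Real.exp (-(μ * y)))
        (Real.exp (-(μ * y)) * -(μ * 1)) y :=
      ((hasDerivAt_id y).const_mul μ).neg.exp
    have ha : HasDerivAt (fun y : ℝ => α + β * y + β / μ) (β * 1) y :=
      (((hasDerivAt_id y).const_mul β).const_add α).add_const _
    refine (ha.mul he).neg.congr_deriv ?_
    field_simp
    ring
  rw [intervalIntegral.integral_eq_sub_of_hasDerivAt hderiv
    (Continuous.intervalIntegrable (by fun_prop) _ _)]
  simp only [mul_zero, neg_zero, Real.exp_zero]
  field_simp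
  ring

/-- The expectation of a function of an exponential variable that is affine up to a threshold and
constant beyond it. -/
lemma integral_truncated_affine_expMeasure {μ L : ℝ} (hμ : 0 < μ) (hL : 0 ≤ L) (α β γ : ℝ)
    {g : ℝ → ℝ} (hg : ∀ y, 0 ≤ y → g y = if y ≤ L then α + β * y else γ) :
    ∫ y, g y ∂(expMeasure μ) =
      γ + (α - γ) * (1 - Real.exp (-(μ * L))) +
        β * ((1 - Real.exp (-(μ * L))) / μ - L * Real.exp (-(μ * L))) := by
  have := isProbabilityMeasure_expMeasure hμ
  have hcongr : ∫ y, g y ∂(expMeasure μ) =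
      ∫ y, (γ + (Icc 0 L).indicator (fun y => α - γ + β * y) y) ∂(expMeasure μ) := by
    refine integral_congr_ae ?_
    filter_upwards [ae_nonneg_expMeasure] with y hy
    rw [hg y hy]
    by_cases h : y ≤ L
    · rw [if_pos h, indicator_of_mem (show y ∈ Icc 0 L from ⟨hy, h⟩)]
      ring
    · rw [if_neg h, indicator_of_notMem fun h' => h h'.2, add_zero]
  have hint : IntegrableOn (fun y => α - γ + β * y) (Icc 0 L) (expMeasure μ) :=
    ContinuousOn.integrableOn_compact isCompact_Icc (by fun_prop)
  rw [hcongr, integral_add (integrable_const _) (hint.integrable_indicator measurableSet_Icc),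
    integral_indicator measurableSet_Icc, setIntegral_affine_expMeasure hμ hL]
  simp
  ring

end ExponentialLaw

/-! ### First-step analysis for a general step law. -/

section FirstStep

/-- The step sequence with first step `z` and subsequent steps `ω`. -/
def prependStep (z : ℝ × ℝ) (ω : ℕ → ℝ × ℝ) : ℕ → ℝ × ℝ
  | 0 => z
  | n + 1 => ω n

lemma measurable_prependStep :
    Measurable fun q : (ℝ × ℝ) × (ℕ → ℝ × ℝ) => prependStep q.1 q.2 := by
  refine measurable_pi_iff.2 fun n => ?_
  cases n with
  | zero => exact measurable_fst
  | succ n => exact (measurable_pi_apply n).comp measurable_snd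

lemma map_prependStep_infinitePi (ν : Measure (ℝ × ℝ)) [IsProbabilityMeasure ν] :
    (ν.prod (Measure.infinitePi fun _ : ℕ => ν)).map (fun q => prependStep q.1 q.2) =
      Measure.infinitePi fun _ : ℕ => ν := by
  classical
  refine Measure.eq_infinitePi _ fun s t ht => ?_
  obtain ⟨N, hN⟩ : ∃ N, s ⊆ Finset.range (N + 1) := by
    obtain ⟨N, hN⟩ := s.exists_nat_subset_range
    exact ⟨N, hN.trans (Finset.range_mono N.le_succ)⟩
  -- Padding the box with full factors, each of measure `1`, replaces `s` by an initial segment,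
  -- from which index `0` splits off as the first step.
  set u : ℕ → Set (ℝ × ℝ) := fun i => if i ∈ s then t i else univ with hu
  have hum : ∀ i, MeasurableSet (u i) := fun i => by
    by_cases hi : i ∈ s <;> simp [hu, hi, ht]
  have hpre : (fun q : (ℝ × ℝ) × (ℕ → ℝ × ℝ) => prependStep q.1 q.2) ⁻¹' Set.pi s t =
      u 0 ×ˢ Set.pi (Finset.range N) (fun i => u (i + 1)) := by
    ext ⟨z, ω⟩
    simp only [mem_preimage, Set.mem_pi, mem_prod, Finset.mem_coe, Finset.mem_range]
    constructor
    · intro H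
      refine ⟨?_, fun i _ => ?_⟩
      · by_cases hi : 0 ∈ s
        · simpa [hu, hi, prependStep] using H 0 hi
        · simp [hu, hi]
      · by_cases hi : i + 1 ∈ s
        · simpa [hu, hi, prependStep] using H (i + 1) hi
        · simp [hu, hi]
    · rintro ⟨H₀, H⟩ i hi
      cases i with
      | zero => simpa [hu, hi, prependStep] using H₀
      | succ i =>
        have hlt := Finset.mem_range.1 (hN hi)
        simpa [hu, hi, prependStep] using H i (by omega)
  rw [Measure.map_apply measurable_prependStep
    (MeasurableSet.pi s.countable_toSet fun i _ => ht i), hpre, Measure.prod_prod,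
    Measure.infinitePi_pi _ fun i _ => hum (i + 1), mul_comm,
    ← Finset.prod_range_succ' (fun i => ν (u i)), ← Finset.prod_subset hN]
  · refine Finset.prod_congr rfl fun i hi => ?_
    simp [hu, hi]
  · intro i _ hi
    simp [hu, hi]

lemma position_zero (x : ℝ) (ω : ℕ → ℝ × ℝ) : position x ω 0 = x := by
  simp [position]

lemma position_prependStep_succ (x : ℝ) (z : ℝ × ℝ) (ω : ℕ → ℝ × ℝ) (n : ℕ) :
    position x (prependStep z ω) (n + 1) = position (x + z.1 * z.2) ω n := by
  simp only [position, Finset.sum_range_succ', prependStep]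
  ring

lemma isExitTime_iff {x h : ℝ} {ω : ℕ → ℝ × ℝ} {n : ℕ} :
    IsExitTime x h ω n ↔ (position x ω n < 0 ∨ h < position x ω n) ∧
      ∀ k < n, ¬ (position x ω k < 0 ∨ h < position x ω k) := by
  refine and_congr Iff.rfl ⟨fun H k hk hk' => ?_, fun H k hk => ?_⟩
  · exact absurd (H hk') (not_le.2 hk)
  · by_contra hlt
    exact H k (not_le.1 hlt) hk

lemma isExitTime_zero {x h : ℝ} {ω : ℕ → ℝ × ℝ} : IsExitTime x h ω 0 ↔ x < 0 ∨ h < x := by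
  simp [isExitTime_iff, position_zero]

lemma isExitTime_prependStep_succ {x h : ℝ} (hx₀ : 0 ≤ x) (hxh : x ≤ h) {z : ℝ × ℝ}
    {ω : ℕ → ℝ × ℝ} {n : ℕ} :
    IsExitTime x h (prependStep z ω) (n + 1) ↔ IsExitTime (x + z.1 * z.2) h ω n := by
  simp only [isExitTime_iff, position_prependStep_succ]
  refine and_congr Iff.rfl ⟨fun H k hk => ?_, fun H k hk => ?_⟩
  · simpa only [position_prependStep_succ] using H (k + 1) (by omega)
  · cases k with
    | zero =>
      rw [position_zero]
      exact not_or.2 ⟨not_lt.2 hx₀, not_lt.2 hxh⟩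
    | succ k =>
      rw [position_prependStep_succ]
      exact H k (by omega)

lemma exitsBelow_prependStep {x h : ℝ} (hx₀ : 0 ≤ x) (hxh : x ≤ h) {z : ℝ × ℝ}
    {ω : ℕ → ℝ × ℝ} :
    (∃ n, IsExitTime x h (prependStep z ω) n ∧ position x (prependStep z ω) n < 0) ↔
      ∃ n, IsExitTime (x + z.1 * z.2) h ω n ∧ position (x + z.1 * z.2) ω n < 0 := by
  constructor
  · rintro ⟨n, hn, hneg⟩
    cases n with
    | zero =>
      rw [position_zero] at hneg
      exact absurd hneg (not_lt.2 hx₀)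
    | succ n =>
      exact ⟨n, (isExitTime_prependStep_succ hx₀ hxh).1 hn, by
        rwa [position_prependStep_succ] at hneg⟩
  · rintro ⟨n, hn, hneg⟩
    exact ⟨n + 1, (isExitTime_prependStep_succ hx₀ hxh).2 hn, by
      rwa [position_prependStep_succ]⟩

lemma measurable_position (n : ℕ) :
    Measurable fun q : ℝ × (ℕ → ℝ × ℝ) => position q.1 q.2 n := by
  unfold position
  fun_prop

/-- Joint measurability in start and steps is what makes `exitBelowProb` measurable in the start and
permits integrating out the first step. -/
lemma measurableSet_exitsBelow (h : ℝ) :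
    MeasurableSet {q : ℝ × (ℕ → ℝ × ℝ) |
      ∃ n, IsExitTime q.1 h q.2 n ∧ position q.1 q.2 n < 0} := by
  have hlt : ∀ n, MeasurableSet {q : ℝ × (ℕ → ℝ × ℝ) | position q.1 q.2 n < 0} :=
    fun n => measurableSet_lt (measurable_position n) measurable_const
  have hgt : ∀ n, MeasurableSet {q : ℝ × (ℕ → ℝ × ℝ) | h < position q.1 q.2 n} :=
    fun n => measurableSet_lt measurable_const (measurable_position n)
  simp only [isExitTime_iff]
  refine measurableSet_setOfPred.2 (Measurable.exists fun n => ?_)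
  refine Measurable.and (Measurable.and ?_ (Measurable.forall fun k => ?_)) ?_
  · exact Measurable.or (measurableSet_setOfPred.1 (hlt n)) (measurableSet_setOfPred.1 (hgt n))
  · exact Measurable.imp measurable_const
      (Measurable.not (Measurable.or (measurableSet_setOfPred.1 (hlt k))
        (measurableSet_setOfPred.1 (hgt k))))
  · exact measurableSet_setOfPred.1 (hlt n)

variable (p : unitInterval) (F : Measure ℝ) [IsProbabilityMeasure F]

instance : IsProbabilityMeasure (stepsLaw p F) := by
  unfold stepsLaw
  infer_instance

lemma measurable_exitBelowProb (h : ℝ) : Measurable fun x => exitBelowProb x h p F := by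
  have := measurable_measure_prodMk_left (ν := stepsLaw p F) (measurableSet_exitsBelow h)
  exact this.ennreal_toReal

lemma exitBelowProb_nonneg (x h : ℝ) : 0 ≤ exitBelowProb x h p F := measureReal_nonneg

lemma exitBelowProb_le_one (x h : ℝ) : exitBelowProb x h p F ≤ 1 := measureReal_le_one

lemma exitBelowProb_of_neg {x : ℝ} (hx : x < 0) (h : ℝ) : exitBelowProb x h p F = 1 := by
  have : {ω | ∃ n, IsExitTime x h ω n ∧ position x ω n < 0} = univ :=
    eq_univ_of_forall fun ω => ⟨0, isExitTime_zero.2 (Or.inl hx), by rwa [position_zero]⟩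
  simp [exitBelowProb, this]

lemma exitBelowProb_of_gt {x h : ℝ} (hh : 0 ≤ h) (hx : h < x) : exitBelowProb x h p F = 0 := by
  have : {ω | ∃ n, IsExitTime x h ω n ∧ position x ω n < 0} = ∅ := by
    refine eq_empty_of_forall_notMem fun ω => ?_
    rintro ⟨n, hn, hneg⟩
    have hn₀ : n = 0 := Nat.le_zero.1 (hn.2 (isExitTime_zero.2 (Or.inr hx)).1)
    rw [hn₀, position_zero] at hneg
    linarith
  simp [exitBelowProb, this]

/-- First step analysis for the two-sided renewal process. -/
lemma exitBelowProb_eq_integral {x h : ℝ} (hx₀ : 0 ≤ x) (hxh : x ≤ h) :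
    exitBelowProb x h p F =
      ∫ z, exitBelowProb (x + z.1 * z.2) h p F ∂((sideLaw p).prod F) := by
  have hS : MeasurableSet {ω : ℕ → ℝ × ℝ | ∃ n, IsExitTime x h ω n ∧ position x ω n < 0} :=
    measurable_prodMk_left (measurableSet_exitsBelow h)
  have hT : MeasurableSet {q : (ℝ × ℝ) × (ℕ → ℝ × ℝ) |
      ∃ n, IsExitTime (x + q.1.1 * q.1.2) h q.2 n ∧
        position (x + q.1.1 * q.1.2) q.2 n < 0} := by
    have hm : Measurable fun q : (ℝ × ℝ) × (ℕ → ℝ × ℝ) =>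
        (x + q.1.1 * q.1.2, q.2) := by fun_prop
    exact hm (measurableSet_exitsBelow h)
  have hmap : stepsLaw p F =
      (((sideLaw p).prod F).prod (stepsLaw p F)).map (fun q => prependStep q.1 q.2) :=
    (map_prependStep_infinitePi ((sideLaw p).prod F)).symm
  rw [integral_eq_lintegral_of_nonneg_ae
    (Filter.Eventually.of_forall fun z => exitBelowProb_nonneg p F _ _)
    ((measurable_exitBelowProb p F h).comp (by fun_prop)).aestronglyMeasurable]
  conv_lhs => rw [exitBelowProb, measureReal_def, hmap,
    Measure.map_apply measurable_prependStep hS]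
  congr 1
  have hpre : (fun q : (ℝ × ℝ) × (ℕ → ℝ × ℝ) => prependStep q.1 q.2) ⁻¹'
      {ω | ∃ n, IsExitTime x h ω n ∧ position x ω n < 0} =
      {q | ∃ n, IsExitTime (x + q.1.1 * q.1.2) h q.2 n ∧
        position (x + q.1.1 * q.1.2) q.2 n < 0} := by
    ext q
    exact exitsBelow_prependStep hx₀ hxh
  rw [hpre, Measure.prod_apply hT]
  refine lintegral_congr fun z => ?_
  rw [exitBelowProb, ofReal_measureReal]
  rfl

end FirstStep

/-! ### Solving the renewal equation for isotropic exponential steps. -/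

section Isotropic

lemma integral_isotropic_prod (F : Measure ℝ) [IsProbabilityMeasure F] {g : ℝ → ℝ}
    (hg : Measurable g) {C : ℝ} (hC : ∀ x, |g x| ≤ C) (x : ℝ) :
    ∫ z, g (x + z.1 * z.2) ∂((sideLaw isotropic).prod F) =
      ((∫ y, g (x + y) ∂F) + ∫ y, g (x - y) ∂F) / 2 := by
  have hint : Integrable (fun z : ℝ × ℝ => g (x + z.1 * z.2)) ((sideLaw isotropic).prod F) :=
    Integrable.of_bound (hg.comp (by fun_prop)).aestronglyMeasurable C
      (Filter.Eventually.of_forall fun z => hC _)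
  rw [integral_prod _ hint, sideLaw,
    integral_add_measure ((integrable_dirac (by simp)).smul_measure ENNReal.ofReal_ne_top)
      ((integrable_dirac (by simp)).smul_measure ENNReal.ofReal_ne_top),
    integral_smul_measure, integral_smul_measure, integral_dirac, integral_dirac]
  have h₁ : (isotropic : ℝ) = 1 / 2 := rfl
  rw [h₁, ENNReal.toReal_ofReal (by norm_num), ENNReal.toReal_ofReal (by norm_num)]
  simp only [one_mul, neg_mul, smul_eq_mul, ← sub_eq_add_neg]
  ring

/-- The probability of an exit below `0` of the isotropic walk with exponential steps, as a
function of the starting point. -/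
noncomputable def affineExitProb (μ h x : ℝ) : ℝ :=
  if x < 0 then 1 else if h < x then 0 else (h * μ + 1 - μ * x) / (h * μ + 2)

lemma measurable_affineExitProb (μ h : ℝ) : Measurable (affineExitProb μ h) := by
  unfold affineExitProb
  refine Measurable.ite measurableSet_Iio measurable_const
    (Measurable.ite measurableSet_Ioi measurable_const (by fun_prop))

lemma abs_affineExitProb_le_one {μ h : ℝ} (hμ : 0 < μ) (hh : 0 ≤ h) (x : ℝ) :
    |affineExitProb μ h x| ≤ 1 := by
  unfold affineExitProb
  split_ifs with h₁ h₂
  · simp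
  · simp
  · have hx₀ := mul_nonneg hμ.le (not_lt.1 h₁)
    have hx := mul_le_mul_of_nonneg_left (not_lt.1 h₂) hμ.le
    have hhμ := mul_nonneg hh hμ.le
    rw [abs_of_nonneg (div_nonneg (by linarith) (by linarith)), div_le_one (by linarith)]
    linarith

/-- The affine exit probability satisfies the renewal equation. -/
lemma affineExitProb_eq_average {μ h x : ℝ} (hμ : 0 < μ) (hx₀ : 0 ≤ x)
    (hxh : x ≤ h) :
    affineExitProb μ h x = ((∫ y, affineExitProb μ h (x + y) ∂(expMeasure μ)) +
      ∫ y, affineExitProb μ h (x - y) ∂(expMeasure μ)) / 2 := by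
  have hC : 0 < h * μ + 2 := by
    have := mul_nonneg (hx₀.trans hxh) hμ.le
    linarith
  -- The exponential terms cancel within each integral: the upward and downward averages are the
  -- value at `x` minus and plus `1 / (h * μ + 2)`.
  rw [integral_truncated_affine_expMeasure hμ (sub_nonneg.2 hxh)
      ((h * μ + 1 - μ * x) / (h * μ + 2)) (-μ / (h * μ + 2)) 0,
    integral_truncated_affine_expMeasure hμ hx₀
      ((h * μ + 1 - μ * x) / (h * μ + 2)) (μ / (h * μ + 2)) 1]
  · rw [affineExitProb, if_neg (not_lt.2 hx₀), if_neg (not_lt.2 hxh)]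
    field_simp
    ring
  · intro y hy
    rw [affineExitProb]
    by_cases hyx : y ≤ x
    · rw [if_neg (by linarith), if_neg (by linarith), if_pos hyx]
      ring
    · rw [if_pos (by linarith), if_neg hyx]
  · intro y hy
    rw [affineExitProb, if_neg (by linarith)]
    by_cases hyx : y ≤ h - x
    · rw [if_neg (by linarith), if_pos hyx]
      ring
    · rw [if_pos (by linarith), if_neg hyx]

/-- A bounded function that vanishes outside `[0, h]` and is harmonic inside for the isotropic walk
with exponential steps is zero. -/
lemma eq_zero_of_eq_average {μ h C : ℝ} (hμ : 0 < μ) (hh : 0 ≤ h) {g : ℝ → ℝ}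
    (hC : ∀ x, |g x| ≤ C)
    (hout : ∀ x, x < 0 ∨ h < x → g x = 0)
    (hin : ∀ x, 0 ≤ x → x ≤ h → g x =
      ((∫ y, g (x + y) ∂(expMeasure μ)) + ∫ y, g (x - y) ∂(expMeasure μ)) / 2) (x : ℝ) :
    g x = 0 := by
  have := isProbabilityMeasure_expMeasure hμ
  have hC₀ : 0 ≤ C := (abs_nonneg _).trans (hC 0)
  -- `r` is the probability that a step is at most `h`. A longer step leaves `[0, h]` from any
  -- start, so each averaging shrinks a uniform bound by the factor `r < 1`.
  set r : ℝ := 1 - Real.exp (-(μ * h)) with hr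
  have hr₀ : 0 ≤ r := by
    have : Real.exp (-(μ * h)) ≤ 1 := Real.exp_le_one_iff.2 (by nlinarith)
    linarith
  have hr₁ : r < 1 := by
    have := Real.exp_pos (-(μ * h))
    linarith
  have hside : ∀ K : ℝ, 0 ≤ K → (∀ x, |g x| ≤ K) → ∀ (f : ℝ → ℝ) (L : ℝ), 0 ≤ L → L ≤ h →
      (∀ y, L < y → g (f y) = 0) → |∫ y, g (f y) ∂(expMeasure μ)| ≤ K * r := by
    intro K hK₀ hK f L hL₀ hLh hf
    have hval := integral_truncated_affine_expMeasure hμ hL₀ K 0 0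
      (g := fun y => if y ≤ L then K + 0 * y else 0) fun y _ => rfl
    have hle : |∫ y, g (f y) ∂(expMeasure μ)| ≤
        ∫ y, (if y ≤ L then K + 0 * y else 0) ∂(expMeasure μ) := by
      refine norm_integral_le_of_norm_le (f := fun y => g (f y)) ?_
        (Filter.Eventually.of_forall fun y => ?_)
      · refine Integrable.of_bound (Measurable.ite measurableSet_Iic (by fun_prop)
          measurable_const).aestronglyMeasurable K (Filter.Eventually.of_forall fun y => ?_)
        split_ifs
        · simp [abs_of_nonneg hK₀]
        · simpa using hK₀
      · rw [Real.norm_eq_abs]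
        split_ifs with hy
        · simpa using hK (f y)
        · rw [hf y (not_le.1 hy), abs_zero]
    refine hle.trans ?_
    rw [hval, hr]
    have : Real.exp (-(μ * h)) ≤ Real.exp (-(μ * L)) :=
      Real.exp_le_exp.2 (neg_le_neg (mul_le_mul_of_nonneg_left hLh hμ.le))
    nlinarith
  have hpow : ∀ n : ℕ, ∀ x, |g x| ≤ C * r ^ n := by
    intro n
    induction n with
    | zero => simpa using hC
    | succ n ih =>
      intro x
      have hK₀ : 0 ≤ C * r ^ n := by positivity
      by_cases hx : x < 0 ∨ h < x
      · rw [hout x hx, abs_zero]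
        positivity
      · obtain ⟨hx₀, hxh⟩ := not_or.1 hx
        rw [not_lt] at hx₀ hxh
        have h₁ := hside _ hK₀ ih (fun y => x + y) (h - x) (by linarith) (by linarith)
          fun y hy => hout _ (Or.inr (by linarith))
        have h₂ := hside _ hK₀ ih (fun y => x - y) x hx₀ hxh
          fun y hy => hout _ (Or.inl (by linarith))
        rw [hin x hx₀ hxh, pow_succ, ← mul_assoc]
        rw [abs_le] at h₁ h₂ ⊢
        constructor <;> linarith [h₁.1, h₁.2, h₂.1, h₂.2]
  have hlim : Filter.Tendsto (fun n : ℕ => C * r ^ n) Filter.atTop (𝓝 0) := by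
    simpa using (tendsto_pow_atTop_nhds_zero_of_lt_one hr₀ hr₁).const_mul C
  exact abs_nonpos_iff.1 (ge_of_tendsto' hlim fun n => hpow n x)

lemma exitBelowProb_isotropic_expMeasure {μ h : ℝ} (hμ : 0 < μ) (hh : 0 ≤ h)
    [IsProbabilityMeasure (expMeasure μ)] (x : ℝ) :
    exitBelowProb x h isotropic (expMeasure μ) = affineExitProb μ h x := by
  have hem := measurable_exitBelowProb isotropic (expMeasure μ) h
  have hab : ∀ x, |exitBelowProb x h isotropic (expMeasure μ)| ≤ 1 := fun x => by
    rw [abs_of_nonneg (exitBelowProb_nonneg _ _ _ _)]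
    exact exitBelowProb_le_one _ _ _ _
  have hae := abs_affineExitProb_le_one hμ hh
  have hint₁ : ∀ f : ℝ → ℝ, Measurable f →
      Integrable (fun y => exitBelowProb (f y) h isotropic (expMeasure μ)) (expMeasure μ) :=
    fun f hf => Integrable.of_bound (hem.comp hf).aestronglyMeasurable 1
      (Filter.Eventually.of_forall fun y => hab _)
  have hint₂ : ∀ f : ℝ → ℝ, Measurable f →
      Integrable (fun y => affineExitProb μ h (f y)) (expMeasure μ) :=
    fun f hf => Integrable.of_bound
      ((measurable_affineExitProb μ h).comp hf).aestronglyMeasurable 1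
      (Filter.Eventually.of_forall fun y => hae _)
  -- The two functions share their values outside `[0, h]` and their equation inside; `2` is the sum
  -- of their bounds.
  refine sub_eq_zero.1 (eq_zero_of_eq_average (C := 2) hμ hh
    (g := fun x => exitBelowProb x h isotropic (expMeasure μ) - affineExitProb μ h x)
    (fun x => (abs_sub _ _).trans (by linarith [hab x, hae x])) ?_ ?_ x)
  · rintro x (hx | hx)
    · simp only [exitBelowProb_of_neg _ _ hx, affineExitProb, if_pos hx, sub_self]
    · simp only [exitBelowProb_of_gt _ _ hh hx, affineExitProb,
        if_neg (not_lt.2 (hh.trans hx.le)), if_pos hx, sub_self]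
  · intro x hx₀ hxh
    rw [integral_sub (hint₁ _ (by fun_prop)) (hint₂ _ (by fun_prop)),
      integral_sub (hint₁ _ (by fun_prop)) (hint₂ _ (by fun_prop)),
      affineExitProb_eq_average hμ hx₀ hxh, exitBelowProb_eq_integral _ _ hx₀ hxh,
      integral_isotropic_prod (expMeasure μ) hem hab x]
    ring

end Isotropic

end PorousBed

theorem theorem3 (μ h θ : ℝ) (hμ : 0 < μ) (hh : 0 ≤ h) (hθ₀ : 0 ≤ θ) (hθ : θ < Real.pi / 2)
    (F : Measure ℝ) [IsProbabilityMeasure F] (hF : F = expMeasure μ) :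
    PorousBed.reflectionFraction h θ F =
      ((1 - Real.cos θ) * (1 - Real.exp (-(h * μ / Real.cos θ))) + h * μ) / (h * μ + 2) := by
  subst hF
  have hc : 0 < Real.cos θ :=
    Real.cos_pos_of_mem_Ioo ⟨by linarith [Real.pi_pos], hθ⟩
  have hC : 0 < h * μ + 2 := by
    have := mul_nonneg hh hμ.le
    linarith
  rw [PorousBed.reflectionFraction]
  simp only [PorousBed.exitBelowProb_isotropic_expMeasure hμ hh]
  -- In terms of the flight length, the bed ends at `h / Real.cos θ`; longer flights are transmitted
  -- and contribute `0`.
  rw [PorousBed.integral_truncated_affine_expMeasure hμ (div_nonneg hh hc.le)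
    ((h * μ + 1) / (h * μ + 2)) (-(μ * Real.cos θ) / (h * μ + 2)) 0]
  · have he : μ * (h / Real.cos θ) = h * μ / Real.cos θ := by ring
    rw [he]
    field_simp
    ring
  · intro l hl
    have hl₀ : 0 ≤ l * Real.cos θ := mul_nonneg hl hc.le
    rw [PorousBed.affineExitProb, if_neg (not_lt.2 hl₀)]
    by_cases hlh : l ≤ h / Real.cos θ
    · rw [if_neg (not_lt.2 ((le_div_iff₀ hc).1 hlh)), if_pos hlh]
      ring
    · rw [if_pos ((div_lt_iff₀ hc).1 (not_le.1 hlh)), if_neg hlh]
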